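/- Let $b>0$, let $v:\mathbb{R}^2\to\mathbb{C}$ be (essentially) bounded and of compact support, and fix $\nu>0$ and $\mu\in\mathbb{C}$. For $B\in\mathbb{C}$ let $H^{\mathrm{Landau}}_B=(P-\tfrac12BX^\perp)^2$ on $L^2(\mathbb{R}^2)$, where $P=-\mathrm{i}\nabla$ and $X^\perp=(-X_2,X_1)$, be realized as any operator that acts as this differential expression in the sense of distributions, on a domain of functions $\psi\in L^2(\mathbb{R}^2)$ with $(P-\tfrac12BX^\perp)^2\psi\in L^2(\mathbb{R}^2)$ that contains $C_c^\infty(\mathbb{R}^2)$ (for example the maximal such domain, or the closure of the operator on $C_c^\infty(\mathbb{R}^2)$). For $\lambda\in\mathbb{C}$ put $z_\lambda:=-\nu\lambda^2+\mu\lambda$. Then there is $\Lambda>0$, depending only on $b,v,\nu,\mu$, such that for every $\lambda\in\mathbb{C}\setminus\mathbb{R}$ with $\operatorname{Re}\lambda>\Lambda$ the operator $$H^{\mathrm{Landau}}_{b\lambda}+\lambda^2v(X)-z_\lambda\mathbb{1}$$ is not invertible, i.e. it is not a bijection of its domain onto $L^2(\mathbb{R}^2)$ with bounded inverse. -/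

import Mathlib

open MeasureTheory
open scoped ContDiff ENNReal

noncomputable section

/-- The plane `ℝ²` with its Euclidean structure. -/
abbrev Plane : Type := EuclideanSpace ℝ (Fin 2)

/-- The complex Hilbert space `L²(ℝ²)`. -/
abbrev L2Plane : Type := Lp ℂ 2 (volume : Measure Plane)

/-- The rotated vector `x^⊥ = (-x₂, x₁)`. -/
def perp (x : Plane) : Plane := !₂[-x 1, x 0]

/-- The `j`-th component of the differential expression `P - ½ B X^⊥`, where `P = -i ∇` and the
field strength `B` may be complex. -/
def magMomentum (B : ℂ) (j : Fin 2) (f : Plane → ℂ) (x : Plane) : ℂ :=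
  -Complex.I * fderiv ℝ f x (EuclideanSpace.single j 1) - (1 / 2) * B * (perp x j : ℂ) * f x

/-- The Landau differential expression `(P - ½ B X^⊥)²` in symmetric gauge. -/
def landauExpr (B : ℂ) (f : Plane → ℂ) (x : Plane) : ℂ :=
  ∑ j : Fin 2, magMomentum B j (magMomentum B j f) x

/-- Complex test functions `C_c^∞(ℝ²)`. -/
def IsTest (f : Plane → ℂ) : Prop := ContDiff ℝ ∞ f ∧ HasCompactSupport f

theorem IsTest.zero : IsTest 0 := ⟨contDiff_const, HasCompactSupport.zero⟩

theorem IsTest.add {f g : Plane → ℂ} (hf : IsTest f) (hg : IsTest g) : IsTest (f + g) :=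
  ⟨hf.1.add hg.1, hf.2.add hg.2⟩

theorem IsTest.const_smul {f : Plane → ℂ} (c : ℂ) (hf : IsTest f) : IsTest (c • f) :=
  ⟨hf.1.const_smul c, hf.2.smul_left (f := fun _ => c)⟩

theorem IsTest.memLp {f : Plane → ℂ} (hf : IsTest f) : MemLp f 2 (volume : Measure Plane) :=
  hf.1.continuous.memLp_of_hasCompactSupport hf.2

theorem contDiff_perp (j : Fin 2) : ContDiff ℝ ∞ fun x : Plane => perp x j := by
  fin_cases j
  · change ContDiff ℝ ∞ fun x : Plane => -x 1
    fun_prop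
  · change ContDiff ℝ ∞ fun x : Plane => x 0
    fun_prop

theorem IsTest.magMomentum_isTest {f : Plane → ℂ} (B : ℂ) (j : Fin 2) (hf : IsTest f) :
    IsTest (magMomentum B j f) := by
  have hp : ContDiff ℝ ∞ fun x : Plane => ((perp x j : ℝ) : ℂ) := by
    exact Complex.ofRealCLM.contDiff.comp (contDiff_perp j)
  refine ⟨?_, ?_⟩
  · have h1 : ContDiff ℝ ∞ (fderiv ℝ f) := hf.1.fderiv_right (by simp)
    have h2 : ContDiff ℝ ∞ fun x => fderiv ℝ f x (EuclideanSpace.single j 1) :=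
      h1.clm_apply contDiff_const
    exact (contDiff_const.mul h2).sub ((contDiff_const.mul hp).mul hf.1)
  · have h1 : HasCompactSupport fun x => fderiv ℝ f x (EuclideanSpace.single j 1) :=
      hf.2.fderiv_apply ℝ (v := EuclideanSpace.single j 1)
    exact (h1.mul_left (f := fun _ => -Complex.I)).sub
      (hf.2.mul_left (f := fun x : Plane => (1 / 2) * B * ((perp x j : ℝ) : ℂ)))

theorem IsTest.landauExpr_isTest {f : Plane → ℂ} (B : ℂ) (hf : IsTest f) :
    IsTest (landauExpr B f) := by
  have h : landauExpr B f
      = magMomentum B 0 (magMomentum B 0 f) + magMomentum B 1 (magMomentum B 1 f) := by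
    funext x
    simp [landauExpr, Fin.sum_univ_two]
  rw [h]
  exact ((hf.magMomentum_isTest B 0).magMomentum_isTest B 0).add ((hf.magMomentum_isTest B 1).magMomentum_isTest B 1)

theorem IsTest.integrable_mul {f : Plane → ℂ} (hf : IsTest f) (ψ : L2Plane) :
    Integrable (fun x => ψ x * f x) (volume : Measure Plane) :=
  (Lp.memLp ψ).integrable_mul hf.memLp

theorem magMomentum_add {f g : Plane → ℂ} (B : ℂ) (j : Fin 2) (hf : IsTest f) (hg : IsTest g) :
    magMomentum B j (f + g) = magMomentum B j f + magMomentum B j g := by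
  funext x
  have hf' : DifferentiableAt ℝ f x := (hf.1.differentiable (by simp)) x
  have hg' : DifferentiableAt ℝ g x := (hg.1.differentiable (by simp)) x
  simp only [magMomentum, fderiv_add hf' hg', Pi.add_apply, add_apply]
  ring

theorem magMomentum_const_smul {f : Plane → ℂ} (B c : ℂ) (j : Fin 2) (hf : IsTest f) :
    magMomentum B j (c • f) = c • magMomentum B j f := by
  funext x
  have hf' : DifferentiableAt ℝ f x := (hf.1.differentiable (by simp)) x
  simp only [magMomentum, fderiv_const_smul hf' c, Pi.smul_apply, smul_apply,
    smul_eq_mul]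
  ring

theorem landauExpr_add {f g : Plane → ℂ} (B : ℂ) (hf : IsTest f) (hg : IsTest g) :
    landauExpr B (f + g) = landauExpr B f + landauExpr B g := by
  funext x
  simp only [landauExpr, Pi.add_apply, ← Finset.sum_add_distrib]
  refine Finset.sum_congr rfl fun j _ => ?_
  rw [magMomentum_add B j hf hg, magMomentum_add B j (hf.magMomentum_isTest B j) (hg.magMomentum_isTest B j)]
  rfl

theorem landauExpr_const_smul {f : Plane → ℂ} (B c : ℂ) (hf : IsTest f) :
    landauExpr B (c • f) = c • landauExpr B f := by
  funext x
  simp only [landauExpr, Pi.smul_apply, Finset.smul_sum]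
  refine Finset.sum_congr rfl fun j _ => ?_
  rw [magMomentum_const_smul B c j hf, magMomentum_const_smul B c j (hf.magMomentum_isTest B j)]
  rfl

/-- Integration by parts: the transpose of `P - ½ B X^⊥` is `-(P + ½ B X^⊥)`. -/
theorem integral_magMomentum_mul {f g : Plane → ℂ} (B : ℂ) (j : Fin 2)
    (hf : IsTest f) (hg : IsTest g) :
    ∫ x, magMomentum B j f x * g x = -∫ x, f x * magMomentum (-B) j g x := by
  have hfc := hf.1.continuous
  have hgc := hg.1.continuous
  have hdf : ContDiff ℝ ∞ fun x => fderiv ℝ f x (EuclideanSpace.single j 1) :=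
    (hf.1.fderiv_right (m := ∞) (by simp)).clm_apply contDiff_const
  have hdg : ContDiff ℝ ∞ fun x => fderiv ℝ g x (EuclideanSpace.single j 1) :=
    (hg.1.fderiv_right (m := ∞) (by simp)).clm_apply contDiff_const
  have i1 : Integrable (fun x => fderiv ℝ f x (EuclideanSpace.single j 1) * g x)
      (volume : Measure Plane) :=
    (hdf.continuous.mul hgc).integrable_of_hasCompactSupport hg.2.mul_left
  have i2 : Integrable (fun x => f x * fderiv ℝ g x (EuclideanSpace.single j 1))
      (volume : Measure Plane) :=
    (hfc.mul hdg.continuous).integrable_of_hasCompactSupport hf.2.mul_right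
  have i3 : Integrable (fun x => f x * g x) (volume : Measure Plane) :=
    (hfc.mul hgc).integrable_of_hasCompactSupport hf.2.mul_right
  have hpc : Continuous fun x : Plane => ((perp x j : ℝ) : ℂ) := by
    exact Complex.continuous_ofReal.comp (contDiff_perp j).continuous
  have i4 : Integrable (fun x => ((perp x j : ℝ) : ℂ) * (f x * g x)) (volume : Measure Plane) :=
    (hpc.mul (hfc.mul hgc)).integrable_of_hasCompactSupport (hf.2.mul_right).mul_left
  have ibp : ∫ x, f x * fderiv ℝ g x (EuclideanSpace.single j 1)
      = -∫ x, fderiv ℝ f x (EuclideanSpace.single j 1) * g x :=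
    integral_mul_fderiv_eq_neg_fderiv_mul_of_integrable i1 i2 i3
      (fun x _ => hf.1.differentiable (by simp) x) (fun x _ => hg.1.differentiable (by simp) x)
  have e1 : ∀ x, magMomentum B j f x * g x
      = -Complex.I * (fderiv ℝ f x (EuclideanSpace.single j 1) * g x)
        - (1 / 2) * B * (((perp x j : ℝ) : ℂ) * (f x * g x)) := by
    intro x
    simp only [magMomentum]
    ring
  have e2 : ∀ x, f x * magMomentum (-B) j g x
      = -Complex.I * (f x * fderiv ℝ g x (EuclideanSpace.single j 1))
        + (1 / 2) * B * (((perp x j : ℝ) : ℂ) * (f x * g x)) := by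
    intro x
    simp only [magMomentum]
    ring
  simp only [e1, e2]
  rw [integral_sub (i1.const_mul _) (i4.const_mul _), integral_add (i2.const_mul _)
    (i4.const_mul _), integral_const_mul, integral_const_mul, integral_const_mul, ibp]
  ring

/-- The transpose of `(P - ½ B X^⊥)²` is `(P + ½ B X^⊥)²`. -/
theorem integral_landauExpr_mul {f g : Plane → ℂ} (B : ℂ) (hf : IsTest f) (hg : IsTest g) :
    ∫ x, landauExpr B f x * g x = ∫ x, f x * landauExpr (-B) g x := by
  simp only [landauExpr, Finset.sum_mul, Finset.mul_sum]
  rw [integral_finsetSum, integral_finsetSum]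
  · refine Finset.sum_congr rfl fun j _ => ?_
    rw [integral_magMomentum_mul B j (hf.magMomentum_isTest B j) hg,
      integral_magMomentum_mul B j hf (hg.magMomentum_isTest (-B) j), neg_neg]
  · intro j _
    exact (hf.1.continuous.mul ((hg.magMomentum_isTest (-B) j).magMomentum_isTest (-B) j).1.continuous
      ).integrable_of_hasCompactSupport hf.2.mul_right
  · intro j _
    exact (((hf.magMomentum_isTest B j).magMomentum_isTest B j).1.continuous.mul hg.1.continuous
      ).integrable_of_hasCompactSupport hg.2.mul_left

/-- The graph of `(P - ½ B X^⊥)²` acting classically on `C_c^∞(ℝ²)`. -/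
def landauCoreGraph (B : ℂ) : Submodule ℂ (L2Plane × L2Plane) where
  carrier := {p | ∃ f : Plane → ℂ, IsTest f ∧ p.1 =ᵐ[volume] f ∧ p.2 =ᵐ[volume] landauExpr B f}
  zero_mem' := by
    refine ⟨0, IsTest.zero, Lp.coeFn_zero _ _ _, ?_⟩
    have h : landauExpr B 0 = 0 := by
      simpa using landauExpr_const_smul B 0 IsTest.zero
    rw [h]
    exact Lp.coeFn_zero _ _ _
  add_mem' := by
    rintro p q ⟨f, hf, h1, h2⟩ ⟨g, hg, h3, h4⟩
    refine ⟨f + g, hf.add hg, (Lp.coeFn_add _ _).trans (h1.add h3), ?_⟩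
    rw [landauExpr_add B hf hg]
    exact (Lp.coeFn_add _ _).trans (h2.add h4)
  smul_mem' := by
    rintro c p ⟨f, hf, h1, h2⟩
    refine ⟨c • f, hf.const_smul c, (Lp.coeFn_smul _ _).trans (h1.const_smul c), ?_⟩
    rw [landauExpr_const_smul B c hf]
    exact (Lp.coeFn_smul _ _).trans (h2.const_smul c)

/-- The graph of `(P - ½ B X^⊥)²` acting in the sense of distributions on those `ψ ∈ L²(ℝ²)` for
which the result `φ` is again in `L²(ℝ²)`. -/
def landauMaxGraph (B : ℂ) : Submodule ℂ (L2Plane × L2Plane) where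
  carrier := {p | ∀ η : Plane → ℂ, IsTest η →
    ∫ x, p.1 x * landauExpr (-B) η x = ∫ x, p.2 x * η x}
  zero_mem' := by
    intro η hη
    have h : ∀ u : Plane → ℂ, ∫ x, (0 : L2Plane) x * u x = 0 := by
      intro u
      rw [← integral_zero Plane ℂ (μ := volume)]
      refine integral_congr_ae ?_
      exact Filter.Eventually.of_forall fun x => by simp
    exact (h _).trans (h _).symm
  add_mem' := by
    intro p q hp hq η hη
    have h : ∀ (ψ φ : L2Plane) (u : Plane → ℂ), IsTest u →
        ∫ x, (ψ + φ) x * u x = (∫ x, ψ x * u x) + ∫ x, φ x * u x := by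
      intro ψ φ u hu
      rw [← integral_add (hu.integrable_mul ψ) (hu.integrable_mul φ)]
      refine integral_congr_ae ?_
      filter_upwards [Lp.coeFn_add ψ φ] with x hx
      rw [hx, Pi.add_apply, add_mul]
    exact (h p.1 q.1 _ (hη.landauExpr_isTest (-B))).trans
      ((congrArg₂ (· + ·) (hp η hη) (hq η hη)).trans (h p.2 q.2 _ hη).symm)
  smul_mem' := by
    intro c p hp η hη
    have h : ∀ (ψ : L2Plane) (u : Plane → ℂ), ∫ x, (c • ψ) x * u x = c * ∫ x, ψ x * u x := by
      intro ψ u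
      rw [← integral_const_mul]
      refine integral_congr_ae ?_
      filter_upwards [Lp.coeFn_smul c ψ] with x hx
      rw [hx, Pi.smul_apply, smul_eq_mul, mul_assoc]
    exact (h p.1 _).trans ((congrArg (c * ·) (hp η hη)).trans (h p.2 _).symm)

theorem landauMaxGraph_single_valued (B : ℂ) (p : L2Plane × L2Plane) (hp : p ∈ landauMaxGraph B)
    (h0 : p.1 = 0) : p.2 = 0 := by
  have hz : ∀ η : Plane → ℂ, IsTest η → ∫ x, p.2 x * η x = 0 := by
    intro η hη
    rw [← hp η hη, h0, ← integral_zero Plane ℂ (μ := volume)]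
    refine integral_congr_ae ?_
    exact Filter.Eventually.of_forall fun x => by simp
  refine Lp.ext ?_
  have hae : ∀ᵐ x ∂(volume : Measure Plane), p.2 x = 0 := by
    refine ae_eq_zero_of_integral_contDiff_smul_eq_zero
      ((Lp.memLp p.2).locallyIntegrable (by norm_num)) ?_
    intro g hg hgc
    have hη : IsTest fun x => (g x : ℂ) :=
      ⟨Complex.ofRealCLM.contDiff.comp hg, hgc.comp_left (g := fun r : ℝ => (r : ℂ)) (by simp)⟩
    rw [← hz _ hη]
    refine integral_congr_ae (Filter.Eventually.of_forall fun x => ?_)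
    simp [mul_comm]
  filter_upwards [hae, Lp.coeFn_zero ℂ 2 (volume : Measure Plane)] with x h1 h2
  rw [h1, h2]
  rfl

theorem landauCoreGraph_le_landauMaxGraph (B : ℂ) : landauCoreGraph B ≤ landauMaxGraph B := by
  rintro p ⟨f, hf, h1, h2⟩ η hη
  have e1 : ∫ x, p.1 x * landauExpr (-B) η x = ∫ x, f x * landauExpr (-B) η x := by
    refine integral_congr_ae ?_
    filter_upwards [h1] with x hx
    rw [hx]
  have e2 : ∫ x, p.2 x * η x = ∫ x, landauExpr B f x * η x := by
    refine integral_congr_ae ?_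
    filter_upwards [h2] with x hx
    rw [hx]
  rw [e1, e2, integral_landauExpr_mul B hf hη]

/-- The Landau operator `(P - ½ B X^⊥)²` in `L²(ℝ²)` with domain `C_c^∞(ℝ²)`. -/
def landauCore (B : ℂ) : L2Plane →ₗ.[ℂ] L2Plane := (landauCoreGraph B).toLinearPMap

/-- The maximal Landau operator `(P - ½ B X^⊥)²` in `L²(ℝ²)`: its domain consists of all
`ψ ∈ L²(ℝ²)` for which `(P - ½ B X^⊥)² ψ`, taken in the sense of distributions, is in
`L²(ℝ²)`. -/
def landauMax (B : ℂ) : L2Plane →ₗ.[ℂ] L2Plane := (landauMaxGraph B).toLinearPMap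

theorem landauCore_graph (B : ℂ) : (landauCore B).graph = landauCoreGraph B :=
  Submodule.toLinearPMap_graph_eq _ fun p hp h0 =>
    landauMaxGraph_single_valued B p (landauCoreGraph_le_landauMaxGraph B hp) h0

theorem landauMax_graph (B : ℂ) : (landauMax B).graph = landauMaxGraph B :=
  Submodule.toLinearPMap_graph_eq _ fun p hp h0 => landauMaxGraph_single_valued B p hp h0

theorem landauCore_le_landauMax (B : ℂ) : landauCore B ≤ landauMax B := by
  apply LinearPMap.le_of_le_graph
  rw [landauCore_graph, landauMax_graph]
  exact landauCoreGraph_le_landauMaxGraph B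

/-- `H` is a realization in `L²(ℝ²)` of the Landau Hamiltonian `(P - ½ B X^⊥)²`: it acts as this
expression, in the sense of distributions, on a domain which contains `C_c^∞(ℝ²)`.  The maximal
operator, the closure of the operator on `C_c^∞(ℝ²)`, and everything in between are
realizations. -/
def IsLandauHamiltonian (B : ℂ) (H : L2Plane →ₗ.[ℂ] L2Plane) : Prop :=
  landauCore B ≤ H ∧ H ≤ landauMax B

theorem isLandauHamiltonian_landauMax (B : ℂ) : IsLandauHamiltonian B (landauMax B) :=
  ⟨landauCore_le_landauMax B, le_rfl⟩

/-- The bounded operator `v(X)` on `L²(ℝ²)` of multiplication by an essentially bounded `v`. -/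
def mulOp (v : Plane → ℂ) (hv : MemLp v ∞ (volume : Measure Plane)) : L2Plane →L[ℂ] L2Plane :=
  (ContinuousLinearMap.mul ℂ ℂ).holderL volume ∞ 2 2 (hv.toLp v)

/-- The operator `T + A`, with the domain of `T`, for an unbounded operator `T` and a bounded
operator `A`. -/
def addBounded (T : L2Plane →ₗ.[ℂ] L2Plane) (A : L2Plane →L[ℂ] L2Plane) :
    L2Plane →ₗ.[ℂ] L2Plane :=
  (A : L2Plane →ₗ[ℂ] L2Plane) +ᵥ T

/-- The unbounded operator `T` is invertible: it is a bijection from its domain onto `L²(ℝ²)` with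
bounded inverse `R`. -/
def IsBoundedlyInvertible (T : L2Plane →ₗ.[ℂ] L2Plane) : Prop :=
  ∃ R : L2Plane →L[ℂ] L2Plane,
    (∀ φ : L2Plane, ∃ h : R φ ∈ T.domain, T ⟨R φ, h⟩ = φ) ∧ ∀ ψ : T.domain, R (T ψ) = ψ

end

/-! Write `B = β + iγ` with `β > 0`, `γ ≠ 0`, and `z = x₀ + i x₁`, `c = (R, 0)`. The Gaussian
`exp(-B|x|²/4 + βRz/2 - βR²/4)` solves the Landau equation at energy `B`, and its modulus `exp(-β|x
- c|²/4)` peaks at `c`. Multiplying it by the `n`-th power of the affine function `B z̄ - βR`, as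
raising operators do, gives energy `B(2n + 1)`. For real `B` that function vanishes at `c`, so only
integer powers are single-valued around the peak. For `γ ≠ 0` its value at `c` is `iγR` and its zero
lies at distance `|γ|R/|B|` from `c`: every complex power `s` is available on a disc of radius
proportional to `R`, and `B(2s + 1)` takes any prescribed value `E`.

Cutting off inside that disc costs only a Gaussian tail, so `exists_pseudomode` yields approximate
solutions at every energy with error exponentially small in `R²`. For large `R` they do not meet the
support of `v`, and they contradict the estimate `eLpNorm_le_of_isBoundedlyInvertible` that a
bounded inverse would give. -/

/-! ### Calculus: locality, and conjugation of the Landau expression by an exponential. -/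

/-- The partial derivative `∂ⱼ f`. -/
noncomputable def pderiv (j : Fin 2) (f : Plane → ℂ) (x : Plane) : ℂ :=
  fderiv ℝ f x (EuclideanSpace.single j 1)

theorem IsTest.pderiv {f : Plane → ℂ} (hf : IsTest f) (j : Fin 2) : IsTest (pderiv j f) :=
  ⟨(hf.1.fderiv_right (m := ∞) (by simp)).clm_apply contDiff_const,
    hf.2.fderiv_apply ℝ (v := EuclideanSpace.single j 1)⟩

theorem IsTest.exists_norm_le {f : Plane → ℂ} (hf : IsTest f) : ∃ C, ∀ x, ‖f x‖ ≤ C :=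
  hf.1.continuous.bounded_above_of_compact_support hf.2

theorem Filter.EventuallyEq.magMomentum_eq {f g : Plane → ℂ} {x : Plane} (h : f =ᶠ[nhds x] g)
    (B : ℂ) (j : Fin 2) : magMomentum B j f x = magMomentum B j g x := by
  simp only [magMomentum, h.fderiv_eq, h.eq_of_nhds]

theorem Filter.EventuallyEq.magMomentum {f g : Plane → ℂ} {x : Plane} (h : f =ᶠ[nhds x] g)
    (B : ℂ) (j : Fin 2) : magMomentum B j f =ᶠ[nhds x] magMomentum B j g :=
  h.eventuallyEq_nhds.mono fun _ hy => hy.magMomentum_eq B j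

theorem Filter.EventuallyEq.landauExpr_eq {f g : Plane → ℂ} {x : Plane} (h : f =ᶠ[nhds x] g)
    (B : ℂ) : landauExpr B f x = landauExpr B g x :=
  Finset.sum_congr rfl fun j _ => (h.magMomentum B j).magMomentum_eq B j

theorem landauExpr_eq_zero_of_notMem_tsupport {f : Plane → ℂ} {x : Plane} (hx : x ∉ tsupport f)
    (B : ℂ) : landauExpr B f x = 0 := by
  have h0 : landauExpr B 0 = 0 := by simpa using landauExpr_const_smul B 0 IsTest.zero
  rw [(notMem_tsupport_iff_eventuallyEq.mp hx).landauExpr_eq B, h0]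
  rfl

theorem magMomentum_mul_exp (B : ℂ) (j : Fin 2) {u ψ : Plane → ℂ} {x : Plane}
    (hu : DifferentiableAt ℝ u x) (hψ : DifferentiableAt ℝ ψ x) :
    magMomentum B j (fun y => u y * Complex.exp (ψ y)) x
      = (-Complex.I * pderiv j u x
          + u x * (-Complex.I * pderiv j ψ x - (1 / 2) * B * (perp x j : ℂ)))
        * Complex.exp (ψ x) := by
  have h := (hu.hasFDerivAt.mul hψ.hasFDerivAt.cexp).fderiv
  simp only [magMomentum, pderiv]
  rw [show (fun y => u y * Complex.exp (ψ y)) = u * fun y => Complex.exp (ψ y) from rfl, h]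
  simp only [add_apply, smul_apply, smul_eq_mul]
  ring

/-- The Landau expression on `χ e^ψ`, where `m` is the momentum field of `e^ψ`. -/
theorem landauExpr_mul_exp (B : ℂ) {χ ψ : Plane → ℂ} (hχ : IsTest χ) {m : Fin 2 → Plane → ℂ}
    {x : Plane} (hψ : ∀ᶠ y in nhds x, DifferentiableAt ℝ ψ y)
    (hm : ∀ j, ∀ᶠ y in nhds x,
      -Complex.I * pderiv j ψ y - (1 / 2) * B * (perp y j : ℂ) = m j y)
    (hmd : ∀ j, DifferentiableAt ℝ (m j) x) :
    landauExpr B (fun y => χ y * Complex.exp (ψ y)) x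
      = (χ x * ∑ j, (-Complex.I * pderiv j (m j) x + m j x ^ 2)
          - ∑ j, (pderiv j (pderiv j χ) x + 2 * Complex.I * pderiv j χ x * m j x))
        * Complex.exp (ψ x) := by
  have hχd : Differentiable ℝ χ := hχ.1.differentiable (by simp)
  have key : ∀ j, magMomentum B j (magMomentum B j fun y => χ y * Complex.exp (ψ y)) x
      = (χ x * (-Complex.I * pderiv j (m j) x + m j x ^ 2)
          - (pderiv j (pderiv j χ) x + 2 * Complex.I * pderiv j χ x * m j x))
        * Complex.exp (ψ x) := by
    intro j
    have hd : DifferentiableAt ℝ (pderiv j χ) x := (hχ.pderiv j).1.differentiable (by simp) x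
    -- Conjugation by `e^ψ` turns the magnetic momentum into `-i∂ⱼ + mⱼ`; this is applied twice.
    have h1 : (magMomentum B j fun y => χ y * Complex.exp (ψ y)) =ᶠ[nhds x]
        fun y => (-Complex.I * pderiv j χ y + χ y * m j y) * Complex.exp (ψ y) := by
      filter_upwards [hψ, hm j] with y h2 h3
      rw [magMomentum_mul_exp B j (hχd y) h2, h3]
    have h4 : HasFDerivAt (fun y => -Complex.I * pderiv j χ y + χ y * m j y) _ x :=
      (hd.hasFDerivAt.const_mul (-Complex.I)).add ((hχd x).hasFDerivAt.mul (hmd j).hasFDerivAt)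
    rw [h1.magMomentum_eq, magMomentum_mul_exp B j h4.differentiableAt hψ.self_of_nhds,
      (hm j).self_of_nhds, pderiv, HasFDerivAt.fderiv h4]
    simp only [add_apply, smul_apply, smul_eq_mul]
    change (-Complex.I * (-Complex.I * pderiv j (pderiv j χ) x
      + (χ x * pderiv j (m j) x + m j x * pderiv j χ x)) + _) * _ = _
    linear_combination (pderiv j (pderiv j χ) x * Complex.exp (ψ x)) * Complex.I_sq
  simp only [landauExpr, key, ← Finset.sum_mul, Finset.sum_sub_distrib, Finset.mul_sum]

/-! ### Cut-off functions. -/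

/-- Cut-off functions at scale `r ≥ 1`, with derivatives bounded independently of `r`. -/
theorem exists_cutoff : ∃ C : ℝ, 0 ≤ C ∧ ∀ r : ℝ, 1 ≤ r → ∀ c : Plane, ∃ χ : Plane → ℂ,
    IsTest χ ∧ (∀ x ∈ Metric.closedBall c r, χ x = 1) ∧
      tsupport χ ⊆ Metric.closedBall c (2 * r) ∧
      ∀ j x, ‖pderiv j χ x‖ ≤ C ∧ ‖pderiv j (pderiv j χ) x‖ ≤ C := by
  let β : ContDiffBump (0 : Plane) := ⟨1, 2, one_pos, one_lt_two⟩
  let η : Plane → ℂ := fun x => (β x : ℂ)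
  have hη : IsTest η := ⟨Complex.ofRealCLM.contDiff.comp β.contDiff,
    β.hasCompactSupport.comp_left (g := fun r : ℝ => (r : ℂ)) (by simp)⟩
  choose C₁ hC₁ using fun j => (hη.pderiv j).exists_norm_le
  choose C₂ hC₂ using fun j => ((hη.pderiv j).pderiv j).exists_norm_le
  have n₁ : ∀ j, 0 ≤ C₁ j := fun j => (norm_nonneg _).trans (hC₁ j 0)
  have n₂ : ∀ j, 0 ≤ C₂ j := fun j => (norm_nonneg _).trans (hC₂ j 0)
  have hle : ∀ j, C₁ j + C₂ j ≤ ∑ i, (C₁ i + C₂ i) := fun j =>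
    Finset.single_le_sum (f := fun i => C₁ i + C₂ i) (fun i _ => add_nonneg (n₁ i) (n₂ i))
      (Finset.mem_univ j)
  refine ⟨∑ j, (C₁ j + C₂ j), Finset.sum_nonneg fun j _ => add_nonneg (n₁ j) (n₂ j), ?_⟩
  intro r hr c
  have r0 : 0 < r := by linarith
  -- Each derivative of the rescaled bump produces a factor `r⁻¹ ≤ 1`, which can be dropped.
  have hri : r⁻¹ ≤ 1 := inv_le_one_of_one_le₀ hr
  have hsc : ∀ (f : Plane → ℂ), IsTest f → ∀ j x, pderiv j (fun y => f (r⁻¹ • (y - c))) x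
      = (r⁻¹ : ℝ) • pderiv j f (r⁻¹ • (x - c)) := by
    intro f hf j x
    have h1 : HasFDerivAt (fun y : Plane => r⁻¹ • (y - c))
        (r⁻¹ • ContinuousLinearMap.id ℝ Plane) x :=
      ((hasFDerivAt_id x).sub_const c).const_smul r⁻¹
    have h2 := ((hf.1.differentiable (by simp)) (r⁻¹ • (x - c))).hasFDerivAt.comp x h1
    simp only [pderiv]
    rw [show (fun y => f (r⁻¹ • (y - c))) = f ∘ fun y => r⁻¹ • (y - c) from rfl, h2.fderiv]
    simp
  have hsupp : tsupport (fun x => η (r⁻¹ • (x - c))) ⊆ Metric.closedBall c (2 * r) := by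
    refine closure_minimal (fun x hx => ?_) Metric.isClosed_closedBall
    by_contra hx'
    apply hx
    have h3 : β (r⁻¹ • (x - c)) = 0 := by
      apply β.zero_of_le_dist
      rw [Metric.mem_closedBall, not_le, dist_eq_norm] at hx'
      rw [dist_zero_right, norm_smul, Real.norm_of_nonneg (by positivity), inv_mul_eq_div,
        le_div_iff₀ r0]
      exact hx'.le
    simp [η, h3]
  have hT : ContDiff ℝ ∞ fun x : Plane => r⁻¹ • (x - c) := by fun_prop
  refine ⟨fun x => η (r⁻¹ • (x - c)), ⟨hη.1.comp hT,
    (isCompact_closedBall c (2 * r)).of_isClosed_subset (isClosed_tsupport _) hsupp⟩, ?_, hsupp, ?_⟩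
  · intro x hx
    have h3 : β (r⁻¹ • (x - c)) = 1 := by
      apply β.one_of_mem_closedBall
      rw [Metric.mem_closedBall, dist_eq_norm] at hx
      rw [mem_closedBall_zero_iff, norm_smul, Real.norm_of_nonneg (by positivity), inv_mul_eq_div,
        div_le_iff₀ r0]
      simpa [β] using hx
    simp [η, h3]
  · intro j x
    have e1 : pderiv j (fun x => η (r⁻¹ • (x - c)))
        = fun x => ((r⁻¹ : ℝ) • pderiv j η) (r⁻¹ • (x - c)) := funext (hsc η hη j)
    have b1 : ‖pderiv j (fun x => η (r⁻¹ • (x - c))) x‖ ≤ C₁ j := by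
      rw [e1]
      simp only [Pi.smul_apply]
      rw [norm_smul, Real.norm_of_nonneg (by positivity)]
      exact (mul_le_of_le_one_left (norm_nonneg _) hri).trans (hC₁ j _)
    have ht : IsTest ((r⁻¹ : ℝ) • pderiv j η) :=
      ⟨(hη.pderiv j).1.const_smul (r⁻¹ : ℝ), (hη.pderiv j).2.smul_left (f := fun _ => (r⁻¹ : ℝ))⟩
    have e2 : pderiv j ((r⁻¹ : ℝ) • pderiv j η) = (r⁻¹ : ℝ) • pderiv j (pderiv j η) := by
      funext y
      simp only [pderiv, Pi.smul_apply]
      have := ((hη.pderiv j).1.differentiable (by simp)) y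
      erw [fderiv_const_smul this]
      rfl
    have b2 : ‖pderiv j (pderiv j (fun x => η (r⁻¹ • (x - c)))) x‖ ≤ C₂ j := by
      rw [e1, hsc _ ht, e2, Pi.smul_apply, norm_smul, norm_smul,
        Real.norm_of_nonneg (by positivity)]
      exact (mul_le_of_le_one_left (by positivity) hri).trans
        ((mul_le_of_le_one_left (norm_nonneg _) hri).trans (hC₂ j _))
    exact ⟨b1.trans (by linarith [hle j, n₂ j]), b2.trans (by linarith [hle j, n₁ j])⟩

/-! ### The a priori estimate implied by a bounded inverse. -/

/-- A bounded left inverse `S` gives `‖ψ‖ ≤ ‖S‖ ‖Tψ‖`. On test functions every realization acts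
classically, so the estimate becomes one about `landauExpr`. -/
theorem eLpNorm_le_of_isBoundedlyInvertible {B : ℂ} {H : L2Plane →ₗ.[ℂ] L2Plane}
    (hH : IsLandauHamiltonian B H) {v : Plane → ℂ} (hv : MemLp v ∞ (volume : Measure Plane))
    (α E : ℂ) (h : IsBoundedlyInvertible
      (addBounded H (α • mulOp v hv - E • ContinuousLinearMap.id ℂ L2Plane))) :
    ∃ K : NNReal, ∀ f : Plane → ℂ, IsTest f →
      eLpNorm f 2 volume
        ≤ K * eLpNorm (fun x => landauExpr B f x + α * (v x * f x) - E * f x) 2 volume := by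
  obtain ⟨S, -, hS⟩ := h
  refine ⟨‖S‖₊, fun f hf => ?_⟩
  have hf' := (hf.landauExpr_isTest B).memLp
  let p : L2Plane := hf.memLp.toLp f
  let p' : L2Plane := hf'.toLp (landauExpr B f)
  have hcore : (p, p') ∈ (landauCore B).graph := by
    rw [landauCore_graph]
    exact ⟨f, hf, hf.memLp.coeFn_toLp, hf'.coeFn_toLp⟩
  have hg := LinearPMap.le_graph_of_le hH.1 hcore
  obtain ⟨y, hy, hHy⟩ := (LinearPMap.mem_graph_iff _).mp hg
  simp only at hy hHy
  have h1 := hS y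
  have h2 : addBounded H (α • mulOp v hv - E • ContinuousLinearMap.id ℂ L2Plane) y
      = (α • mulOp v hv p - E • p) + p' := by
    rw [← hy, ← hHy]
    rfl
  have h3 : ‖(y : L2Plane)‖ₑ ≤ ‖S‖₊ * ‖(α • mulOp v hv p - E • p) + p'‖ₑ := by
    rw [← h2]
    conv_lhs => rw [← h1]
    exact S.le_opENorm _
  rw [hy, Lp.enorm_def, Lp.enorm_def] at h3
  have e1 : eLpNorm p 2 volume = eLpNorm f 2 volume := eLpNorm_congr_ae hf.memLp.coeFn_toLp
  rw [e1] at h3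
  refine h3.trans (mul_le_mul_right (le_of_eq (eLpNorm_congr_ae ?_)) _)
  have hm : mulOp v hv p =ᵐ[volume] fun x => v x * f x := by
    have h4 := (ContinuousLinearMap.mul ℂ ℂ).coeFn_holder (r := 2) (hv.toLp v) p
    filter_upwards [h4, hv.coeFn_toLp, hf.memLp.coeFn_toLp] with x h5 h6 h7
    have : mulOp v hv p x = _ := h5
    rw [this, h6, h7]
    rfl
  filter_upwards [Lp.coeFn_add (α • mulOp v hv p - E • p) p', Lp.coeFn_sub (α • mulOp v hv p) (E • p),
    Lp.coeFn_smul α (mulOp v hv p), Lp.coeFn_smul E p, hm, hf.memLp.coeFn_toLp,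
    hf'.coeFn_toLp] with x a1 a2 a3 a4 a5 a6 a7
  rw [a1, Pi.add_apply, a2, Pi.sub_apply, a3, a4, Pi.smul_apply, Pi.smul_apply, a5, a6, a7]
  simp only [smul_eq_mul]
  ring

/-! ### Beams: exact local solutions at arbitrary energy. -/

/-- The affine function `1 + B (z̄ - R) / (i γ R)` of `z̄ = x₀ - i x₁`. -/
noncomputable def beamBase (B : ℂ) (γ R : ℝ) (x : Plane) : ℂ :=
  1 + B / (Complex.I * γ * R) * ((x 0 : ℂ) - Complex.I * (x 1 : ℂ) - R)

/-- The phase of a beam centred at `(R, 0)`, of energy `B (2 s + 1)`. -/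
noncomputable def beamPhase (B s : ℂ) (β γ R : ℝ) (x : Plane) : ℂ :=
  -B / 4 * ((x 0 : ℂ) ^ 2 + (x 1 : ℂ) ^ 2) + β * R / 2 * ((x 0 : ℂ) + Complex.I * (x 1 : ℂ))
    - β * R ^ 2 / 4 + s * Complex.log (beamBase B γ R x)

/-- The momentum field of a beam. -/
noncomputable def beamMomentum (B s : ℂ) (γ R : ℝ) (j : Fin 2) (x : Plane) : ℂ :=
  ![Complex.I / 2, -1 / 2] j * (Complex.I * γ * R * beamBase B γ R x)
    - ![Complex.I, 1] j * (s * B) / (Complex.I * γ * R) * (beamBase B γ R x)⁻¹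

theorem hasFDerivAt_ofReal_coord (i : Fin 2) (x : Plane) :
    HasFDerivAt (fun y : Plane => (y i : ℂ))
      (Complex.ofRealCLM ∘L (EuclideanSpace.proj i : Plane →L[ℝ] ℝ)) x :=
  (Complex.ofRealCLM ∘L (EuclideanSpace.proj i : Plane →L[ℝ] ℝ)).hasFDerivAt

theorem hasFDerivAt_beamBase (B : ℂ) (γ R : ℝ) (x : Plane) :
    HasFDerivAt (beamBase B γ R) ((B / (Complex.I * γ * R)) •
      (Complex.ofRealCLM ∘L (EuclideanSpace.proj 0 : Plane →L[ℝ] ℝ)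
        - Complex.I • (Complex.ofRealCLM ∘L (EuclideanSpace.proj 1 : Plane →L[ℝ] ℝ)))) x :=
  ((((hasFDerivAt_ofReal_coord 0 x).sub
    ((hasFDerivAt_ofReal_coord 1 x).const_mul Complex.I)).sub_const _).const_mul _).const_add _

theorem contDiff_beamBase (B : ℂ) (γ R : ℝ) : ContDiff ℝ ∞ (beamBase B γ R) := by
  have h : ∀ i : Fin 2, ContDiff ℝ ∞ fun y : Plane => (y i : ℂ) := fun i =>
    (Complex.ofRealCLM ∘L (EuclideanSpace.proj i : Plane →L[ℝ] ℝ)).contDiff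
  exact contDiff_const.add (contDiff_const.mul
    (((h 0).sub (contDiff_const.mul (h 1))).sub contDiff_const))

theorem contDiffAt_beamPhase (B s : ℂ) (β γ R : ℝ) {x : Plane}
    (hx : beamBase B γ R x ∈ Complex.slitPlane) : ContDiffAt ℝ ∞ (beamPhase B s β γ R) x := by
  have h : ∀ i : Fin 2, ContDiff ℝ ∞ fun y : Plane => (y i : ℂ) := fun i =>
    (Complex.ofRealCLM ∘L (EuclideanSpace.proj i : Plane →L[ℝ] ℝ)).contDiff
  have h1 : ContDiffAt ℝ ∞ (fun y => Complex.log (beamBase B γ R y)) x :=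
    ((Complex.contDiffAt_log hx).restrict_scalars ℝ).comp x (contDiff_beamBase B γ R).contDiffAt
  refine ContDiffAt.add (ContDiff.contDiffAt ?_) (contDiffAt_const.mul h1)
  exact ((contDiff_const.mul (((h 0).pow 2).add ((h 1).pow 2))).add
    (contDiff_const.mul ((h 0).add (contDiff_const.mul (h 1))))).sub contDiff_const

theorem pderiv_beamPhase {B s : ℂ} {β γ R : ℝ} (hB : B = β + γ * Complex.I) (hγ : γ ≠ 0)
    (hR : R ≠ 0) {x : Plane} (hx : beamBase B γ R x ∈ Complex.slitPlane) (j : Fin 2) :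
    -Complex.I * pderiv j (beamPhase B s β γ R) x - (1 / 2) * B * (perp x j : ℂ)
      = beamMomentum B s γ R j x := by
  have h0 := hasFDerivAt_ofReal_coord 0 x
  have h1 := hasFDerivAt_ofReal_coord 1 x
  have hl := ((Complex.hasStrictDerivAt_log hx).hasDerivAt.hasFDerivAt.restrictScalars ℝ).comp x
    (hasFDerivAt_beamBase B γ R x)
  have h : HasFDerivAt (beamPhase B s β γ R) _ x :=
    (((((h0.pow 2).add (h1.pow 2)).const_mul (-B / 4)).add
      ((h0.add (h1.const_mul Complex.I)).const_mul ((β : ℂ) * R / 2))).sub_const _).add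
      (hl.const_mul s)
  have hγ' : (γ : ℂ) ≠ 0 := by exact_mod_cast hγ
  have hR' : (R : ℂ) ≠ 0 := by exact_mod_cast hR
  have hI := Complex.I_ne_zero
  -- The affine factor is `B z̄ - βR`, normalized to equal `1` at `(R, 0)`.
  have hq : Complex.I * γ * R * beamBase B γ R x
      = B * ((x 0 : ℂ) - Complex.I * (x 1 : ℂ)) - β * R := by
    simp only [beamBase]
    field_simp
    rw [hB]
    ring
  simp only [beamMomentum]
  rw [hq, pderiv, h.fderiv]
  generalize (beamBase B γ R x)⁻¹ = w
  generalize Complex.I * (γ : ℂ) * R = D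
  fin_cases j
  · simp [perp]
    linear_combination (B * x 1 / 2) * Complex.I_sq
  · simp [perp]
    linear_combination (s * B / D * w - β * R / 2) * Complex.I_sq

/-- The vectors `(i/2, -1/2)` and `(i, 1)` are isotropic for the bilinear square, so squaring leaves
only the cross term `2sB`. The divergence of the first part contributes `B`; that of the second
vanishes, because `i∂₀ + ∂₁` annihilates functions of `z̄`. -/
theorem sum_beamMomentum {B s : ℂ} {γ R : ℝ} {x : Plane} (hx : beamBase B γ R x ≠ 0)
    (hγ : γ ≠ 0) (hR : R ≠ 0) :
    ∑ j, (-Complex.I * pderiv j (beamMomentum B s γ R j) x + beamMomentum B s γ R j x ^ 2)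
      = B * (2 * s + 1) := by
  have hγ' : (γ : ℂ) ≠ 0 := by exact_mod_cast hγ
  have hR' : (R : ℂ) ≠ 0 := by exact_mod_cast hR
  have hI := Complex.I_ne_zero
  have hb := hasFDerivAt_beamBase B γ R x
  have h : ∀ j, HasFDerivAt (beamMomentum B s γ R j) _ x := fun j =>
    ((hb.const_mul (Complex.I * γ * R)).const_mul (![Complex.I / 2, -1 / 2] j)).sub
      ((((hasDerivAt_inv hx).hasFDerivAt.restrictScalars ℝ).comp x hb).const_mul _)
  rw [Fin.sum_univ_two]
  simp only [pderiv, (h _).fderiv]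
  simp [beamMomentum]
  generalize beamBase B γ R x = w at hx ⊢
  have hD : Complex.I * (γ : ℂ) * R ≠ 0 := mul_ne_zero (mul_ne_zero hI hγ') hR'
  generalize Complex.I * (γ : ℂ) * R = D at hD ⊢
  have h1 : w * w⁻¹ = 1 := mul_inv_cancel₀ hx
  have h2 : D * D⁻¹ = 1 := mul_inv_cancel₀ hD
  linear_combination (-D * D⁻¹ * B + D ^ 2 * w ^ 2 / 4 - s * B * D * D⁻¹ * w * w⁻¹
    + s ^ 2 * B ^ 2 * D⁻¹ ^ 2 * w⁻¹ ^ 2) * Complex.I_sq + (B + 2 * s * B * w * w⁻¹) * h2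
    + 2 * s * B * h1

theorem differentiableAt_beamMomentum (B s : ℂ) (γ R : ℝ) {x : Plane}
    (hx : beamBase B γ R x ≠ 0) (j : Fin 2) :
    DifferentiableAt ℝ (beamMomentum B s γ R j) x := by
  have hb := (hasFDerivAt_beamBase B γ R x).differentiableAt
  exact ((hb.const_mul _).const_mul _).sub
    ((((hasDerivAt_inv hx).differentiableAt.restrictScalars ℝ).comp x hb).const_mul _)

/-! ### Size of the beams. -/

theorem norm_coord_sub (R : ℝ) (x : Plane) :
    ‖(x 0 : ℂ) - Complex.I * (x 1 : ℂ) - R‖ = dist x (EuclideanSpace.single 0 R) := by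
  rw [EuclideanSpace.dist_eq, Fin.sum_univ_two, Complex.norm_eq_sqrt_sq_add_sq]
  simp [Real.dist_eq]

theorem norm_beamBase_sub_one_le {B : ℂ} {γ R : ℝ} (hγ : γ ≠ 0) (hB : B ≠ 0) (hR : 0 < R)
    {x : Plane} (hx : dist x (EuclideanSpace.single 0 R) ≤ |γ| / (2 * ‖B‖) * R) :
    ‖beamBase B γ R x - 1‖ ≤ 1 / 2 := by
  have hB' : 0 < ‖B‖ := norm_pos_iff.mpr hB
  have hγ' : 0 < |γ| := abs_pos.mpr hγ
  rw [beamBase, add_sub_cancel_left, norm_mul, norm_coord_sub, norm_div, norm_mul, norm_mul,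
    Complex.norm_I, one_mul, Complex.norm_real, Complex.norm_real, Real.norm_eq_abs,
    Real.norm_of_nonneg hR.le]
  calc _ ≤ ‖B‖ / (|γ| * R) * (|γ| / (2 * ‖B‖) * R) := by gcongr
    _ = 1 / 2 := by field_simp

/-- The imaginary part `γ` of the field enters the Gaussian factor only through its phase; the
modulus is centred at `(R, 0)`. -/
theorem re_beamPhase {B : ℂ} (s : ℂ) {β γ R : ℝ} (hB : B = β + γ * Complex.I) (x : Plane) :
    (beamPhase B s β γ R x).re = -β / 4 * dist x (EuclideanSpace.single 0 R) ^ 2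
      + (s * Complex.log (beamBase B γ R x)).re := by
  rw [EuclideanSpace.dist_eq, Real.sq_sqrt (Finset.sum_nonneg fun i _ => sq_nonneg _),
    Fin.sum_univ_two]
  have e : beamPhase B s β γ R x = ((-β / 4 * ((x 0 - R) ^ 2 + x 1 ^ 2) : ℝ) : ℂ)
      + ((-γ / 4 * (x 0 ^ 2 + x 1 ^ 2) + β * R / 2 * x 1 : ℝ) : ℂ) * Complex.I
      + s * Complex.log (beamBase B γ R x) := by
    rw [beamPhase, hB]
    push_cast
    ring
  rw [e]
  simp only [Complex.add_re, Complex.re_ofReal_mul, Complex.I_re, Complex.ofReal_re]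
  simp [Real.dist_eq]

theorem abs_re_mul_log_le (s : ℂ) {w : ℂ} (hw : ‖w - 1‖ ≤ 1 / 2) :
    |(s * Complex.log w).re| ≤ ‖s‖ := by
  -- This gives `|log w| ≤ (3/2)|w - 1| ≤ 3/4`.
  have h := Complex.norm_log_one_add_half_le_self hw
  rw [add_sub_cancel] at h
  refine (Complex.abs_re_le_norm _).trans ?_
  rw [norm_mul]
  exact mul_le_of_le_one_right (norm_nonneg _) (by linarith)

theorem norm_beamMomentum_le (B s : ℂ) {γ R : ℝ} (hγ : γ ≠ 0) (hR : 1 ≤ R) {x : Plane}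
    (hw : ‖beamBase B γ R x - 1‖ ≤ 1 / 2) (j : Fin 2) :
    ‖beamMomentum B s γ R j x‖ ≤ (|γ| + 2 * ‖s‖ * ‖B‖ / |γ|) * R := by
  have hγ' : 0 < |γ| := abs_pos.mpr hγ
  have R0 : 0 < R := by linarith
  rw [beamMomentum]
  generalize beamBase B γ R x = w at hw
  have w1 : ‖w‖ ≤ 2 := by
    have := norm_le_norm_add_norm_sub' w 1
    rw [norm_one] at this
    linarith
  have w2 : 1 / 2 ≤ ‖w‖ := by
    have := norm_le_norm_add_norm_sub' 1 w
    rw [norm_one, norm_sub_rev] at this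
    linarith
  have w3 : ‖w⁻¹‖ ≤ 2 := by
    rw [norm_inv]
    exact inv_le_of_inv_le₀ (by norm_num) (by linarith)
  have n1 : ‖(![Complex.I / 2, -1 / 2] j : ℂ)‖ = 1 / 2 := by fin_cases j <;> simp
  have n2 : ‖(![Complex.I, 1] j : ℂ)‖ = 1 := by fin_cases j <;> simp
  have nD : ‖Complex.I * (γ : ℂ) * R‖ = |γ| * R := by
    simp [abs_of_pos R0]
  refine (norm_sub_le _ _).trans ?_
  rw [norm_mul, norm_mul _ w, norm_mul _ w⁻¹, nD, n1, norm_div, norm_mul, n2, nD,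
    norm_mul s, one_mul, add_mul]
  refine add_le_add ?_ ?_
  · nlinarith [mul_pos hγ' R0]
  · calc _ ≤ ‖s‖ * ‖B‖ / (|γ| * R) * 2 := by gcongr
      _ ≤ ‖s‖ * ‖B‖ / (|γ| * 1) * 2 := by gcongr
      _ = 2 * ‖s‖ * ‖B‖ / |γ| * 1 := by ring
      _ ≤ 2 * ‖s‖ * ‖B‖ / |γ| * R := by gcongr

/-! ### Pseudomodes. -/

/-- Pseudomodes of the Landau operator with non-real field `B`, at any energy `E`, localized
near `(R, 0)`. -/
theorem exists_pseudomode {B : ℂ} {β γ : ℝ} (hB : B = β + γ * Complex.I) (hβ : 0 < β) (hγ : γ ≠ 0)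
    (E : ℂ) : ∃ a k C R₀ : ℝ, 0 < a ∧ 0 < k ∧ 0 ≤ C ∧ ∀ R, R₀ ≤ R → ∃ f : Plane → ℂ,
      IsTest f ∧ tsupport f ⊆ Metric.closedBall (EuclideanSpace.single 0 R) (R / 2) ∧
      (∀ x ∈ Metric.closedBall (EuclideanSpace.single 0 R : Plane) 1, a ≤ ‖f x‖) ∧
      ∀ x, ‖landauExpr B f x - E * f x‖ ≤ C * R * Real.exp (-k * R ^ 2) := by
  have hγ' : 0 < |γ| := abs_pos.mpr hγ
  have hγB : |γ| ≤ ‖B‖ := by simpa [hB] using Complex.abs_im_le_norm B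
  have hB0 : 0 < ‖B‖ := hγ'.trans_le hγB
  have hBne : B ≠ 0 := norm_pos_iff.mp hB0
  -- The cut-off at scale `δR` is supported in radius `2δR = |γ|R/(2|B|)`, halfway to the zero of
  -- `beamBase`; since `δ ≤ 1/4` this is at most `R/2`.
  obtain ⟨δ, hδ⟩ : ∃ δ, δ = |γ| / (4 * ‖B‖) := ⟨_, rfl⟩
  have hδ0 : 0 < δ := by rw [hδ]; positivity
  have hδ4 : δ ≤ 1 / 4 := by
    rw [hδ, div_le_iff₀ (by positivity)]
    linarith
  have hδ2 : |γ| / (2 * ‖B‖) = 2 * δ := by rw [hδ]; field_simp; norm_num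
  obtain ⟨s, hs⟩ : ∃ s : ℂ, B * (2 * s + 1) = E := ⟨(E / B - 1) / 2, by field_simp; ring⟩
  obtain ⟨C, hC0, hC⟩ := exists_cutoff
  set K := |γ| + 2 * ‖s‖ * ‖B‖ / |γ| with hK
  have hK0 : 0 ≤ K := by positivity
  -- The requirement `R ≥ 1/δ` makes `δR ≥ 1`, so the unit ball lies where the cut-off is `1`.
  refine ⟨Real.exp (-β / 4 - ‖s‖), β / 4 * δ ^ 2, (2 * C + 4 * C * K) * Real.exp ‖s‖,
    max 1 (1 / δ), Real.exp_pos _, by positivity, by positivity, ?_⟩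
  intro R hR
  have hR1 : 1 ≤ R := (le_max_left _ _).trans hR
  have hR0 : 0 < R := by linarith
  have hRδ : 1 ≤ δ * R := by
    have := (le_max_right _ _).trans hR
    rwa [div_le_iff₀ hδ0, mul_comm] at this
  set c : Plane := EuclideanSpace.single 0 R
  obtain ⟨χ, hχ, hχ1, hχs, hχd⟩ := hC (δ * R) hRδ c
  have hbase : ∀ x ∈ Metric.closedBall c (2 * (δ * R)), ‖beamBase B γ R x - 1‖ ≤ 1 / 2 :=
    fun x hx => norm_beamBase_sub_one_le hγ hBne hR0
      ((Metric.mem_closedBall.mp hx).trans (by rw [hδ2]; linarith))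
  have hslit : ∀ x ∈ Metric.closedBall c (2 * (δ * R)), beamBase B γ R x ∈ Complex.slitPlane := by
    intro x hx
    have := Complex.mem_slitPlane_of_norm_lt_one ((hbase x hx).trans_lt one_half_lt_one)
    rwa [add_sub_cancel] at this
  have hopen : IsOpen {x | beamBase B γ R x ∈ Complex.slitPlane} :=
    Complex.isOpen_slitPlane.preimage (contDiff_beamBase B γ R).continuous
  let ψ := beamPhase B s β γ R
  let f : Plane → ℂ := fun x => χ x * Complex.exp (ψ x)
  have hnorm : ∀ x, ‖Complex.exp (ψ x)‖ = Real.exp (-β / 4 * dist x c ^ 2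
      + (s * Complex.log (beamBase B γ R x)).re) := fun x => by
    rw [Complex.norm_exp, re_beamPhase s hB]
  have hfs : tsupport f ⊆ tsupport χ := tsupport_mul_subset_left
  have hχ0 : ∀ x ∉ Metric.closedBall c (2 * (δ * R)), x ∉ tsupport f :=
    fun x hx h => hx (hχs (hfs h))
  have hf : IsTest f := by
    refine ⟨contDiff_iff_contDiffAt.mpr fun x => ?_, hχ.2.mul_right⟩
    by_cases hx : x ∈ Metric.closedBall c (2 * (δ * R))
    · exact hχ.1.contDiffAt.mul (contDiffAt_beamPhase B s β γ R (hslit x hx)).cexp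
    · exact contDiffAt_const.congr_of_eventuallyEq
        (notMem_tsupport_iff_eventuallyEq.mp (hχ0 x hx))
  refine ⟨f, hf, (hfs.trans hχs).trans (Metric.closedBall_subset_closedBall (by nlinarith)), ?_, ?_⟩
  · intro x hx
    have hx1 : x ∈ Metric.closedBall c (δ * R) := Metric.closedBall_subset_closedBall hRδ hx
    have hx2 : x ∈ Metric.closedBall c (2 * (δ * R)) :=
      Metric.closedBall_subset_closedBall (by linarith) hx1
    rw [norm_mul, hχ1 x hx1, norm_one, one_mul, hnorm]
    have h1 := (abs_le.mp (abs_re_mul_log_le s (hbase x hx2))).1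
    have h2 : dist x c ^ 2 ≤ 1 := pow_le_one₀ dist_nonneg (Metric.mem_closedBall.mp hx)
    exact Real.exp_le_exp.mpr (by nlinarith)
  · intro x
    have hpos : 0 ≤ (2 * C + 4 * C * K) * Real.exp ‖s‖ * R
        * Real.exp (-(β / 4 * δ ^ 2) * R ^ 2) := by positivity
    by_cases hx : x ∈ Metric.closedBall c (2 * (δ * R))
    swap
    · rw [landauExpr_eq_zero_of_notMem_tsupport (hχ0 x hx),
        image_eq_zero_of_notMem_tsupport (hχ0 x hx)]
      simpa using hpos
    have hev : ∀ᶠ y in nhds x, beamBase B γ R y ∈ Complex.slitPlane :=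
      hopen.mem_nhds (hslit x hx)
    have hne := Complex.slitPlane_ne_zero (hslit x hx)
    have key : landauExpr B f x - E * f x
        = -(∑ j, (pderiv j (pderiv j χ) x
            + 2 * Complex.I * pderiv j χ x * beamMomentum B s γ R j x)) * Complex.exp (ψ x) := by
      have := landauExpr_mul_exp B (ψ := ψ) (x := x) hχ (m := beamMomentum B s γ R)
        (hev.mono fun y hy => (contDiffAt_beamPhase B s β γ R hy).differentiableAt (by simp))
        (fun j => hev.mono fun y hy => pderiv_beamPhase hB hγ hR0.ne' hy j)
        (differentiableAt_beamMomentum B s γ R hne)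
      rw [this, sum_beamMomentum hne hγ hR0.ne', hs]
      simp only [f]
      ring
    -- The error is the commutator with `χ`: it vanishes on the inner ball, and on the annulus the
    -- Gaussian is at most `exp(-βδ²R²/4)` up to `e^{‖s‖}`.
    by_cases hx1 : x ∈ Metric.ball c (δ * R)
    · have h1 : χ =ᶠ[nhds x] fun _ => 1 := by
        filter_upwards [Metric.isOpen_ball.mem_nhds hx1] with y hy
        exact hχ1 y (Metric.ball_subset_closedBall hy)
      have h2 : ∀ j, pderiv j χ =ᶠ[nhds x] fun _ => 0 := fun j => by
        filter_upwards [h1.eventuallyEq_nhds] with y hy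
        simp [pderiv, hy.fderiv_eq]
      have h3 : ∀ j, pderiv j (pderiv j χ) x = 0 := fun j => by
        rw [pderiv, (h2 j).fderiv_eq]
        simp
      rw [key]
      simp only [h3, fun j => (h2 j).eq_of_nhds]
      simpa using hpos
    · rw [Metric.mem_ball, not_lt] at hx1
      have h1 := (abs_le.mp (abs_re_mul_log_le s (hbase x hx))).2
      have h2 : (δ * R) ^ 2 ≤ dist x c ^ 2 := by gcongr
      have h3 : ‖Complex.exp (ψ x)‖ ≤ Real.exp ‖s‖ * Real.exp (-(β / 4 * δ ^ 2) * R ^ 2) := by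
        rw [hnorm, ← Real.exp_add]
        exact Real.exp_le_exp.mpr (by nlinarith)
      have h4 : ∀ j, ‖pderiv j (pderiv j χ) x
          + 2 * Complex.I * pderiv j χ x * beamMomentum B s γ R j x‖ ≤ C * R + 2 * C * (K * R) := by
        intro j
        refine (norm_add_le _ _).trans (add_le_add ?_ ?_)
        · exact (hχd j x).2.trans (le_mul_of_one_le_right hC0 hR1)
        · rw [norm_mul, norm_mul, norm_mul, Complex.norm_I, Complex.norm_two, mul_one]
          have := norm_beamMomentum_le B s hγ hR1 (hbase x hx) j
          have := (hχd j x).1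
          gcongr
      rw [key, norm_mul, norm_neg]
      calc _ ≤ (∑ _j : Fin 2, (C * R + 2 * C * (K * R)))
            * (Real.exp ‖s‖ * Real.exp (-(β / 4 * δ ^ 2) * R ^ 2)) := by
            gcongr
            exact norm_sum_le_of_le _ fun j _ => h4 j
        _ = _ := by
            rw [Fin.sum_univ_two]
            ring

/-! ### Norms in `L²` from pointwise bounds. -/

theorem volume_closedBall_plane (c : Plane) {r : ℝ} (hr : 0 ≤ r) :
    volume (Metric.closedBall c r) ^ (1 / (2 : ℝ≥0∞).toReal)
      = ENNReal.ofReal r * volume (Metric.ball (0 : Plane) 1) ^ (1 / (2 : ℝ≥0∞).toReal) := by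
  rw [Measure.addHaar_closedBall _ _ hr, finrank_euclideanSpace_fin,
    ENNReal.mul_rpow_of_nonneg _ _ (by positivity), ENNReal.ofReal_pow hr, ← ENNReal.rpow_natCast,
    ← ENNReal.rpow_mul]
  norm_num

theorem eLpNorm_le_of_support {f : Plane → ℂ} {c : Plane} {r M : ℝ} (hr : 0 ≤ r)
    (h0 : ∀ x ∉ Metric.closedBall c r, f x = 0) (hM : ∀ x, ‖f x‖ ≤ M) :
    eLpNorm f 2 volume ≤ ENNReal.ofReal (M * r)
      * volume (Metric.ball (0 : Plane) 1) ^ (1 / (2 : ℝ≥0∞).toReal) := by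
  have hM0 : 0 ≤ M := (norm_nonneg _).trans (hM c)
  have h : eLpNorm f 2 volume
      ≤ eLpNorm ((Metric.closedBall c r).indicator fun _ => M) 2 volume := by
    refine eLpNorm_mono_real fun x => ?_
    by_cases hx : x ∈ Metric.closedBall c r
    · simpa [Set.indicator_of_mem hx] using hM x
    · simp [Set.indicator_of_notMem hx, h0 x hx]
  refine h.trans (le_of_eq ?_)
  rw [eLpNorm_indicator_const Metric.isClosed_closedBall.measurableSet (by simp) (by simp),
    volume_closedBall_plane c hr, ENNReal.ofReal_mul hM0, Real.enorm_of_nonneg hM0, mul_assoc]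

theorem le_eLpNorm_of_le_norm {f : Plane → ℂ} {c : Plane} {a : ℝ} (ha : 0 ≤ a)
    (h : ∀ x ∈ Metric.closedBall c 1, a ≤ ‖f x‖) :
    ENNReal.ofReal a * volume (Metric.ball (0 : Plane) 1) ^ (1 / (2 : ℝ≥0∞).toReal)
      ≤ eLpNorm f 2 volume := by
  have h1 : eLpNorm ((Metric.closedBall c 1).indicator fun _ => a) 2 volume
      ≤ eLpNorm f 2 volume := by
    refine eLpNorm_mono fun x => ?_
    by_cases hx : x ∈ Metric.closedBall c 1
    · simpa [Set.indicator_of_mem hx, abs_of_nonneg ha] using h x hx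
    · simp [Set.indicator_of_notMem hx]
  rwa [eLpNorm_indicator_const Metric.isClosed_closedBall.measurableSet (by simp) (by simp),
    volume_closedBall_plane c zero_le_one, Real.enorm_of_nonneg ha, ENNReal.ofReal_one,
    one_mul] at h1

theorem tendsto_sq_mul_exp_neg_mul_sq {k : ℝ} (hk : 0 < k) :
    Filter.Tendsto (fun R : ℝ => R ^ 2 * Real.exp (-k * R ^ 2)) Filter.atTop (nhds 0) := by
  have h := (tendsto_rpow_mul_exp_neg_mul_atTop_nhds_zero 1 k hk).comp
    (Filter.tendsto_pow_atTop (α := ℝ) two_ne_zero)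
  simpa [Function.comp_def] using h

/-! ### The contradiction. -/

theorem propositionE2 (b : ℝ) (hb : 0 < b) (v : Plane → ℂ)
    (hv : MemLp v ∞ (volume : Measure Plane)) (hvc : HasCompactSupport v)
    (ν : ℝ) (hν : 0 < ν) (μ : ℂ) :
    ∃ Λ : ℝ, 0 < Λ ∧ ∀ lam : ℂ, lam.im ≠ 0 → Λ < lam.re →
      ∀ H : L2Plane →ₗ.[ℂ] L2Plane, IsLandauHamiltonian ((b : ℂ) * lam) H →
        ¬ IsBoundedlyInvertible
          (addBounded H (lam ^ 2 • mulOp v hv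
            - (-(ν : ℂ) * lam ^ 2 + μ * lam) • ContinuousLinearMap.id ℂ L2Plane)) := by
  -- Any positive `Λ` would do: `Re λ > Λ` serves only to make `β = b Re λ` positive.
  refine ⟨1, one_pos, fun lam him hre H hH hinv => ?_⟩
  generalize -(ν : ℂ) * lam ^ 2 + μ * lam = E at hinv
  obtain ⟨K, hK⟩ := eLpNorm_le_of_isBoundedlyInvertible hH hv (lam ^ 2) E hinv
  have hB : (b : ℂ) * lam = ((b * lam.re : ℝ) : ℂ) + ((b * lam.im : ℝ) : ℂ) * Complex.I := by
    apply Complex.ext <;> simp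
  obtain ⟨a, k, C, R₀, ha, hk, hC, hf⟩ := exists_pseudomode hB (mul_pos hb (by linarith))
    (mul_ne_zero hb.ne' him) E
  obtain ⟨M, hM⟩ := hvc.isBounded.subset_closedBall (0 : Plane)
  have hlim := (tendsto_sq_mul_exp_neg_mul_sq hk).const_mul (K * C / 2)
  rw [mul_zero] at hlim
  -- `R > 2M` separates the ball of radius `R/2` about `(R, 0)` from the support of `v`.
  obtain ⟨R, hlt, hR₀, hRM, hR1⟩ := ((hlim.eventually (gt_mem_nhds ha)).and
    ((Filter.eventually_ge_atTop R₀).and ((Filter.eventually_gt_atTop (2 * M)).and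
      (Filter.eventually_ge_atTop 1)))).exists
  obtain ⟨f, hft, hfs, hfa, hfe⟩ := hf R hR₀
  have hR0 : 0 ≤ R := by linarith
  have hvf : ∀ x, v x * f x = 0 := by
    intro x
    by_contra hne
    have h1 := hfs (subset_tsupport _ (right_ne_zero_of_mul hne))
    have h2 := hM (subset_tsupport _ (left_ne_zero_of_mul hne))
    have h3 : dist (EuclideanSpace.single 0 R : Plane) 0 = R := by
      simp [abs_of_nonneg hR0]
    have h4 := dist_triangle_left (EuclideanSpace.single 0 R : Plane) 0 x
    rw [Metric.mem_closedBall] at h1 h2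
    linarith
  have hle := hK f hft
  simp only [hvf, mul_zero, add_zero] at hle
  have hup := eLpNorm_le_of_support (half_pos (by linarith : 0 < R)).le (fun x hx => by
    rw [landauExpr_eq_zero_of_notMem_tsupport (fun h => hx (hfs h)),
      image_eq_zero_of_notMem_tsupport (fun h => hx (hfs h)), mul_zero, sub_zero]) hfe
  have hchain := ((le_eLpNorm_of_le_norm ha.le hfa).trans hle).trans (mul_le_mul_right hup _)
  have hV0 : volume (Metric.ball (0 : Plane) 1) ^ (1 / (2 : ℝ≥0∞).toReal) ≠ 0 :=
    (ENNReal.rpow_pos (Metric.measure_ball_pos _ _ one_pos) measure_ball_lt_top.ne).ne'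
  have hVt : volume (Metric.ball (0 : Plane) 1) ^ (1 / (2 : ℝ≥0∞).toReal) ≠ ⊤ :=
    ENNReal.rpow_ne_top_of_nonneg (by positivity) measure_ball_lt_top.ne
  -- Both sides carry the square root of the area of the unit disc; cancelling it leaves `a ≤ (KC/2)
  -- R² exp(-kR²)`, against the choice of `R`.
  rw [← mul_assoc, ENNReal.mul_le_mul_iff_left hV0 hVt, ← ENNReal.ofReal_coe_nnreal,
    ← ENNReal.ofReal_mul K.coe_nonneg, ENNReal.ofReal_le_ofReal_iff (by positivity)] at hchain
  have e : (K : ℝ) * (C * R * Real.exp (-k * R ^ 2) * (R / 2))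
      = K * C / 2 * (R ^ 2 * Real.exp (-k * R ^ 2)) := by ring
  linarith
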